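/- **Setting.** Let $G_1,\dots,G_m$ be weighted digraphs on the nodes $\{1,\dots,N\}$, where $G_p$ has a weighted adjacency matrix $A_p=[a^p_{ij}]$ with $a^p_{ij}>0$ if $(i,j)$ is an edge of $G_p$ and $a^p_{ij}=0$ otherwise, and let $L_p=\mathrm{diag}\big(\sum_j a^p_{ij}\big)_i-A_p$ be its Laplacian. Let $t_0$ be the initial time and let $\sigma$ be a switching signal with values in $\{1,\dots,m\}$ that is admissible: there are times $t_0<t_1<t_2<\cdots$ and $t_L>0$ with $t_{k+1}-t_k>t_L$ for all $k$ such that * $\sigma$ is constant on each $[t_k,t_{k+1})$; * $G_{\sigma(t)}$ is weight-balanced ($\sum_j a_{ji}=\sum_j a_{ij}$ for every $i$) for all $t\ge t_0$; * there is an infinite sequence of contiguous intervals $[t_{i_j},t_{i_{j+1}})$, $j=1,2,\dots$, with $t_{i_1}=t_0$, $i_1<i_2<\cdots$ and uniformly bounded lengths, such that for every $j$ the union of the digraphs $G_{\sigma(t)}$, $t\in[t_{i_j},t_{i_{j+1}})$, is strongly connected. Let $R\in\mathbb R^{N\times(N-1)}$ be such that $T=[\tfrac1{\sqrt N}\mathbf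 1_N\ \ R]$ satisfies $T^\top T=TT^\top=I_N$, and let $\Pi=I_N-\frac1N\mathbf 1_N\mathbf 1_N^\top$. Say that $(\kappa,\underline\lambda)$ with $\kappa\ge1$, $\underline\lambda>0$ is a uniform exponential bound for the switched reduced Laplacian dynamics $\dot z=-R^\top L_{\sigma(t)}R\,z$ if every solution on $[s,\infty)$, for every $s\ge t_0$, satisfies $\|z(t)\|\le\kappa e^{-\underline\lambda(t-s)}\|z(s)\|$ for all $t\ge s$ (Euclidean norms). **Lemma.** There exists a uniform exponential bound $(\kappa,\underline\lambda)$ with $\kappa\ge 1$, $\underline\lambda>0$. Moreover, let $(\kappa,\underline\lambda)$ be any such bound. Let $\mathsf u^1,\dots,\mathsf u^N:[t_0,\infty)\to\mathbb R$ be reference signals that are differentiable (it suffices that they are continuous and have a right derivative at every $t\ge t_0$, denoted $\dot{\mathsf u}^i(t)$), let $\mathsf u^{\mathrm{avg}}=\frac1N\sum_i\mathsf u^i$, and suppose that $\gamma(t)=\sup_{\tau\ge t}\|\Pi\,\dot{\mathsf u}(\tau)\|<\infty$ for $t\ge t_0$. Let $x$ be a trajectory of $$\dot x^i(t)=-\sum_{j=1}^N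 a^{\sigma(t)}_{ij}\big(x^i(t)-x^j(t)\big)+\dot{\mathsf u}^i(t),\qquad t\ge t_0,\ i=1,\dots,N,$$ that is, $x$ is continuous and satisfies the equation for all $t\ge t_0$ with $\dot x^i$ the right derivative. Then: 1. The tracking errors $x^i-\mathsf u^{\mathrm{avg}}$ are bounded on $[t_0,\infty)$; in particular, if $\mathsf u^{\mathrm{avg}}$ is bounded, then so is $x$. 2. If $\sum_i x^i(t_0)=\sum_i\mathsf u^i(t_0)$, then * the limit $\gamma(\infty)=\lim_{t\to\infty}\gamma(t)$ exists and, for every $i$, $$\limsup_{t\to\infty}\big|x^i(t)-\mathsf u^{\mathrm{avg}}(t)\big|\le\frac{\kappa\,\gamma(\infty)}{\underline\lambda};$$ * the rate of convergence to the error bound is at least $\underline\lambda$, in the sense that for every $i$ and all $t\ge s\ge t_0$ $$\big|x^i(t)-\mathsf u^{\mathrm{avg}}(t)\big|\le\kappa\,e^{-\underline\lambda(t-s)}\|\Pi x(s)\|+\frac{\kappa\,\gamma(s)}{\underline\lambda};$$ * $\sum_i x^i(t)=\sum_i\mathsf u^i(t)$ for all $t\ge t_0$. -/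

import Mathlib

open Filter Topology

/-- A weighted digraph on the nodes `Fin N`: a digraph together with a real adjacency matrix
whose entry `a i j` is positive on edges and zero elsewhere. -/
structure WeightedDigraph (N : ℕ) extends Digraph (Fin N) where
  /-- the weighted adjacency matrix -/
  a : Matrix (Fin N) (Fin N) ℝ
  pos_of_adj : ∀ i j, Adj i j → 0 < a i j
  zero_of_not_adj : ∀ i j, ¬ Adj i j → a i j = 0

/-- At every node the two weighted degrees (column sum and row sum of the adjacency matrix)
coincide. -/
def WeightedDigraph.WeightBalanced {N : ℕ} (G : WeightedDigraph N) : Prop :=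
  ∀ i, ∑ j, G.a j i = ∑ j, G.a i j

/-- The Laplacian matrix `L = D - A`, that is, `(L x) i = ∑ j, a i j * (x i - x j)`. -/
noncomputable def WeightedDigraph.laplacian {N : ℕ} (G : WeightedDigraph N) :
    Matrix (Fin N) (Fin N) ℝ :=
  Matrix.diagonal (fun i => ∑ j, G.a i j) - G.a

/-- Every node can be reached from every node along directed edges. -/
def StronglyConnected {N : ℕ} (D : Digraph (Fin N)) : Prop :=
  ∀ i j, Relation.ReflTransGen D.Adj i j

/-- Admissible switching signals from the initial time `t₀` on: there are times
`t₀ = t 0 < t 1 < ...` with a positive dwell time, the signal is constant on each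
`[t k, t (k+1))`, the active digraph is always weight-balanced, and there is an infinite sequence
of contiguous intervals `[t (n j), t (n (j+1)))`, starting at `t₀` and of uniformly bounded
length, over each of which the union of the active digraphs is strongly connected. -/
def IsAdmissible {N m : ℕ} (G : Fin m → WeightedDigraph N) (σ : ℝ → Fin m) (t₀ : ℝ) : Prop :=
  ∃ t : ℕ → ℝ, t 0 = t₀ ∧
    (∃ tL : ℝ, 0 < tL ∧ ∀ k, tL < t (k + 1) - t k) ∧
    (∀ k, ∀ τ ∈ Set.Ico (t k) (t (k + 1)), σ τ = σ (t k)) ∧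
    (∀ τ, t₀ ≤ τ → (G (σ τ)).WeightBalanced) ∧
    ∃ n : ℕ → ℕ, n 0 = 0 ∧ StrictMono n ∧
      (∃ B : ℝ, ∀ j, t (n (j + 1)) - t (n j) ≤ B) ∧
      ∀ j, StronglyConnected
        (⨆ τ ∈ Set.Ico (t (n j)) (t (n (j + 1))), (G (σ τ)).toDigraph)

/-- The matrix `Π = I - (1/N) 1 1ᵀ`. -/
noncomputable def centering (N : ℕ) : Matrix (Fin N) (Fin N) ℝ :=
  1 - (1 / (N : ℝ)) • Matrix.of fun _ _ => (1 : ℝ)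

/-- The matrix `T = [ (1/√N) 1   R ]` obtained by bordering `R` with the consensus direction. -/
noncomputable def transformMatrix {N : ℕ} (R : Matrix (Fin N) (Fin (N - 1)) ℝ) :
    Matrix (Fin N) (Unit ⊕ Fin (N - 1)) ℝ :=
  Matrix.fromCols (Matrix.of fun _ _ => 1 / Real.sqrt N) R

/-- The columns of `R` complete the consensus direction to an orthonormal basis:
`Tᵀ T = I` and `T Tᵀ = I`. -/
def IsDisagreementBasis {N : ℕ} (R : Matrix (Fin N) (Fin (N - 1)) ℝ) : Prop :=
  (transformMatrix R).transpose * transformMatrix R = 1 ∧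
    transformMatrix R * (transformMatrix R).transpose = 1

/-- `z` solves the switched reduced Laplacian dynamics `z' = -Rᵀ L_{σ(t)} R z` on `[s, ∞)`:
it is continuous and the equation holds with the right derivative at every time
(for a right-continuous piecewise constant `σ` this means: with the derivative between switches). -/
def IsReducedSolution {N m : ℕ} (G : Fin m → WeightedDigraph N) (σ : ℝ → Fin m)
    (R : Matrix (Fin N) (Fin (N - 1)) ℝ) (s : ℝ)
    (z : ℝ → EuclideanSpace ℝ (Fin (N - 1))) : Prop :=
  ContinuousOn z (Set.Ici s) ∧
    ∀ t, s ≤ t → HasDerivWithinAt z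
      (-(Matrix.toEuclideanCLM (𝕜 := ℝ) (R.transpose * (G (σ t)).laplacian * R) (z t)))
      (Set.Ici t) t

/-- The uniform exponential bound `‖Φ(t, s)‖ ≤ κ e^{-lam (t - s)}`, `t ≥ s ≥ t₀`, for the
transition matrix `Φ` of the switched reduced Laplacian dynamics, in terms of its solutions
`z t = Φ(t, s) (z s)`. -/
def UniformExpBound {N m : ℕ} (G : Fin m → WeightedDigraph N) (σ : ℝ → Fin m) (t₀ : ℝ)
    (R : Matrix (Fin N) (Fin (N - 1)) ℝ) (κ lam : ℝ) : Prop :=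
  ∀ s, t₀ ≤ s → ∀ z, IsReducedSolution G σ R s z →
    ∀ t, s ≤ t → ‖z t‖ ≤ κ * Real.exp (-lam * (t - s)) * ‖z s‖

/-- `v` is a family of continuous signals on `[t₀, ∞)` with right derivatives `dv`; any family of
differentiable signals with derivatives `dv` is of this kind. -/
def HasRate {N : ℕ} (t₀ : ℝ) (v dv : Fin N → ℝ → ℝ) : Prop :=
  ∀ i, ContinuousOn (v i) (Set.Ici t₀) ∧
    ∀ t, t₀ ≤ t → HasDerivWithinAt (v i) (dv i t) (Set.Ici t) t

/-- Trajectories on `[t₀, ∞)` of the dynamic average consensus algorithm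
`x_i' = -∑ j, a_ij (x_i - x_j) + u_i'` over the switching digraph. -/
def IsTrajectory {N m : ℕ} (G : Fin m → WeightedDigraph N) (σ : ℝ → Fin m) (t₀ : ℝ)
    (du x : Fin N → ℝ → ℝ) : Prop :=
  HasRate t₀ x fun i t => -(∑ j, (G (σ t)).a i j * (x i t - x j t)) + du i t

/-- The average `(1/N) ∑ i, u_i(t)`. -/
noncomputable def avg {N : ℕ} (u : Fin N → ℝ → ℝ) (t : ℝ) : ℝ :=
  (1 / (N : ℝ)) * ∑ i, u i t

/-- The Euclidean norm `‖Π v(t)‖`. -/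
noncomputable def disagreement {N : ℕ} (v : Fin N → ℝ → ℝ) (t : ℝ) : ℝ :=
  ‖WithLp.toLp 2 ((centering N).mulVec fun i => v i t)‖

/-- `γ(t) = sup_{τ ≥ t} ‖Π u'(τ)‖`. -/
noncomputable def gammaSup {N : ℕ} (du : Fin N → ℝ → ℝ) (t : ℝ) : ℝ :=
  sSup (disagreement du '' Set.Ici t)

/-!
The proof works in disagreement coordinates `z = Rᵀ x`, in which the algorithm becomes the switched
reduced Laplacian dynamics with input `Rᵀ u'`, and has two parts.

*Exponential stability of the reduced dynamics.* For a weight-balanced digraph the energy `‖z‖²`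
decays at the rate `E = ∑ a i j (y i - y j)²`, `y = R z`, and `‖z'‖² ≤ M E` for a constant `M`.
Hence over a time interval of bounded length the displacement of `z` is controlled by the energy
lost (`norm_sub_le_of_dissipation`). If on such an interval the union of the active digraphs is
strongly connected and little energy is lost, then each edge of the union was active for at least
the dwell time, so `y` nearly agrees along it; as `z` has hardly moved, this holds at the initial
time for all edges simultaneously, and by connectivity for all pairs of nodes. Since `y` has mean
zero, `‖z‖` is then less than itself, which is absurd. So the energy shrinks by a uniform
factor (`exists_contraction`), and iterating gives the exponential bound
(`exists_uniformExpBound`).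

*Response to the input.* Products of matrix exponentials give a transition matrix `Φ` with its
inverse (`exists_fundamental_solution`), so that a uniform exponential bound estimates `‖Φ(T, τ)‖`.
The mean value inequality for the right derivative of `τ ↦ Φ(T, τ) z(τ)` then yields
`‖z(T)‖ ≤ κ exp (-lam (T - s)) ‖z(s)‖ + κ g / lam` for inputs bounded by `g`
(`UniformExpBound.norm_le`), without any integrability of the input. Together with the
conservation of `∑ x - ∑ u` (`IsTrajectory.sum_sub_sum_eq`) and `‖Rᵀ v‖ = ‖Π v‖` this gives all the
assertions on the tracking error.
-/

/-! ### Disagreement coordinates -/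

section DisagreementCoordinates

open Matrix

theorem norm_toLp_sq {ι : Type*} [Fintype ι] (v : ι → ℝ) : ‖WithLp.toLp 2 v‖ ^ 2 = v ⬝ᵥ v := by
  rw [EuclideanSpace.real_norm_sq_eq]
  simp [dotProduct, sq]

theorem abs_apply_le_norm {ι : Type*} [Fintype ι] (v : ι → ℝ) (i : ι) :
    |v i| ≤ ‖WithLp.toLp 2 v‖ := by
  simpa using PiLp.norm_apply_le (WithLp.toLp 2 v) i

theorem centering_mulVec_apply {N : ℕ} (v : Fin N → ℝ) (i : Fin N) :
    (centering N *ᵥ v) i = v i - (1 / (N : ℝ)) * ∑ j, v j := by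
  rw [centering, sub_mulVec, smul_mulVec, one_mulVec]
  simp [mulVec, dotProduct]

variable {N : ℕ} {R : Matrix (Fin N) (Fin (N - 1)) ℝ}

namespace IsDisagreementBasis

theorem pos (hR : IsDisagreementBasis R) : 0 < N := by
  rcases Nat.eq_zero_or_pos N with rfl | h
  · have := congrFun (congrFun hR.1 (Sum.inl ())) (Sum.inl ())
    simp [Matrix.mul_apply] at this
  · exact h

theorem transpose_mul (hR : IsDisagreementBasis R) : Rᵀ * R = 1 := by
  ext i j
  have := congrFun (congrFun hR.1 (Sum.inr i)) (Sum.inr j)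
  simpa [Matrix.mul_apply, transformMatrix, Matrix.one_apply] using this

theorem mul_transpose (hR : IsDisagreementBasis R) : R * Rᵀ = centering N := by
  ext i j
  have := congrFun (congrFun hR.2 i) j
  have hs : (√(N : ℝ))⁻¹ * (√(N : ℝ))⁻¹ = (N : ℝ)⁻¹ := by
    rw [← mul_inv, Real.mul_self_sqrt (Nat.cast_nonneg N)]
  simp only [transformMatrix, one_div, mul_apply, transpose_apply, Fintype.sum_sum_type,
    Finset.univ_unique, fromCols_apply_inl, of_apply, hs, Finset.sum_const, Finset.card_singleton,
    one_smul, fromCols_apply_inr] at this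
  simp only [centering, one_div, mul_apply, transpose_apply, Matrix.sub_apply,
    Matrix.smul_apply, of_apply, smul_eq_mul, mul_one]
  linarith

theorem sum_col (hR : IsDisagreementBasis R) (k : Fin (N - 1)) : ∑ i, R i k = 0 := by
  have := congrFun (congrFun hR.1 (Sum.inl ())) (Sum.inr k)
  have hN : (√(N : ℝ))⁻¹ ≠ 0 := by
    have := hR.pos
    positivity
  simp only [transformMatrix, mul_apply, transpose_apply, fromCols_apply_inl, of_apply,
    fromCols_apply_inr, ← Finset.mul_sum, one_div] at this
  rw [Matrix.one_apply_ne (by simp)] at this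
  exact (mul_eq_zero.mp this).resolve_left hN

theorem sum_mulVec (hR : IsDisagreementBasis R) (v : Fin (N - 1) → ℝ) :
    ∑ i, (R *ᵥ v) i = 0 := by
  simp only [mulVec, dotProduct]
  rw [Finset.sum_comm]
  simp [← Finset.sum_mul, hR.sum_col]

theorem norm_mulVec (hR : IsDisagreementBasis R) (v : Fin (N - 1) → ℝ) :
    ‖WithLp.toLp 2 (R *ᵥ v)‖ = ‖WithLp.toLp 2 v‖ := by
  rw [← sq_eq_sq₀ (norm_nonneg _) (norm_nonneg _), norm_toLp_sq, norm_toLp_sq,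
    dotProduct_mulVec, ← mulVec_transpose, mulVec_mulVec, hR.transpose_mul, one_mulVec]

theorem norm_transpose_mulVec (hR : IsDisagreementBasis R) (v : Fin N → ℝ) :
    ‖WithLp.toLp 2 (Rᵀ *ᵥ v)‖ = ‖WithLp.toLp 2 (centering N *ᵥ v)‖ := by
  rw [← hR.norm_mulVec, mulVec_mulVec, hR.mul_transpose]

theorem dotProduct_transpose_mulVec_le (hR : IsDisagreementBasis R) (v : Fin N → ℝ) :
    (Rᵀ *ᵥ v) ⬝ᵥ (Rᵀ *ᵥ v) ≤ v ⬝ᵥ v := by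
  have h1 : (Rᵀ *ᵥ v) ⬝ᵥ (Rᵀ *ᵥ v) = v ⬝ᵥ (centering N *ᵥ v) := by
    rw [← hR.mul_transpose, ← mulVec_mulVec, dotProduct_mulVec v, ← mulVec_transpose]
  have h2 : v ⬝ᵥ (centering N *ᵥ v) = v ⬝ᵥ v - (1 / (N : ℝ)) * (∑ j, v j) ^ 2 := by
    simp only [dotProduct, centering_mulVec_apply, mul_sub, Finset.sum_sub_distrib]
    rw [← Finset.sum_mul]
    ring
  rw [h1, h2]
  have : 0 ≤ (1 / (N : ℝ)) * (∑ j, v j) ^ 2 := by positivity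
  linarith

/-- A vector of disagreement coordinates is controlled by the pairwise differences of the
corresponding node values, because these have mean zero. -/
theorem norm_le_of_abs_sub_le (hR : IsDisagreementBasis R) (v : EuclideanSpace ℝ (Fin (N - 1)))
    {c : ℝ} (h : ∀ i j, |(R *ᵥ v) i - (R *ᵥ v) j| ≤ c) : ‖v‖ ≤ N * c := by
  have hN : (0 : ℝ) < N := by exact_mod_cast hR.pos
  have h1 : ∀ i, |(R *ᵥ v) i| ≤ c := by
    intro i
    have h2 : (N : ℝ) * (R *ᵥ v) i = ∑ j, ((R *ᵥ v) i - (R *ᵥ v) j) := by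
      simp [Finset.sum_sub_distrib, hR.sum_mulVec]
    have h3 : (N : ℝ) * |(R *ᵥ v) i| ≤ N * c := by
      rw [← abs_of_pos hN, ← abs_mul, abs_of_pos hN, h2]
      refine (Finset.abs_sum_le_sum_abs _ _).trans ((Finset.sum_le_sum fun j _ => h i j).trans ?_)
      simp
    exact le_of_mul_le_mul_left h3 hN
  have hc : 0 ≤ c := (abs_nonneg _).trans (h1 ⟨0, hR.pos⟩)
  have h4 : ‖v‖ = ‖WithLp.toLp 2 (R *ᵥ v)‖ := by rw [hR.norm_mulVec]
  rw [h4]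
  refine abs_le_of_sq_le_sq' ?_ (by positivity) |>.2
  rw [norm_toLp_sq, dotProduct]
  have hN1 : (1 : ℝ) ≤ N := by exact_mod_cast hR.pos
  calc ∑ i, (R *ᵥ v) i * (R *ᵥ v) i ≤ ∑ _i : Fin N, c ^ 2 := by
        refine Finset.sum_le_sum fun i _ => ?_
        rw [← sq]
        exact sq_le_sq' (by linarith [neg_abs_le ((R *ᵥ v) i), h1 i]) ((le_abs_self _).trans (h1 i))
    _ = N * c ^ 2 := by simp
    _ ≤ (N * c) ^ 2 := by
        rw [mul_pow]
        exact mul_le_mul_of_nonneg_right (by nlinarith) (sq_nonneg c)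

theorem abs_sub_le (hR : IsDisagreementBasis R) (v : EuclideanSpace ℝ (Fin (N - 1)))
    (i j : Fin N) : |(R *ᵥ v) i - (R *ᵥ v) j| ≤ 2 * ‖v‖ := by
  have h := hR.norm_mulVec v
  have h1 := abs_apply_le_norm (R *ᵥ v) i
  have h2 := abs_apply_le_norm (R *ᵥ v) j
  rw [h] at h1 h2
  simp only [WithLp.toLp_ofLp] at h1 h2
  linarith [abs_sub ((R *ᵥ v) i) ((R *ᵥ v) j)]

end IsDisagreementBasis

end DisagreementCoordinates

/-! ### The Laplacian of a weight-balanced digraph -/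

namespace WeightedDigraph

open Matrix

variable {N : ℕ} (G : WeightedDigraph N)

theorem a_nonneg (i j : Fin N) : 0 ≤ G.a i j := by
  by_cases h : G.Adj i j
  · exact (G.pos_of_adj i j h).le
  · exact (G.zero_of_not_adj i j h).ge

/-- The disagreement energy `∑ a i j (y i - y j)²`, which for weight-balanced digraphs is twice
the quadratic form of the Laplacian. -/
def edgeEnergy (y : Fin N → ℝ) : ℝ := ∑ i, ∑ j, G.a i j * (y i - y j) ^ 2

theorem le_edgeEnergy (y : Fin N → ℝ) (i j : Fin N) :
    G.a i j * (y i - y j) ^ 2 ≤ G.edgeEnergy y := by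
  have hnn : ∀ i j, 0 ≤ G.a i j * (y i - y j) ^ 2 := fun i j =>
    mul_nonneg (G.a_nonneg i j) (sq_nonneg _)
  refine (Finset.single_le_sum (f := fun j => G.a i j * (y i - y j) ^ 2)
    (fun j _ => hnn i j) (Finset.mem_univ j)).trans ?_
  exact Finset.single_le_sum (f := fun i => ∑ j, G.a i j * (y i - y j) ^ 2)
    (fun i _ => Finset.sum_nonneg fun j _ => hnn i j) (Finset.mem_univ i)

theorem edgeEnergy_nonneg (y : Fin N → ℝ) : 0 ≤ G.edgeEnergy y :=
  Finset.sum_nonneg fun i _ => Finset.sum_nonneg fun j _ =>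
    mul_nonneg (G.a_nonneg i j) (sq_nonneg _)

theorem laplacian_mulVec_apply (y : Fin N → ℝ) (i : Fin N) :
    (G.laplacian *ᵥ y) i = ∑ j, G.a i j * (y i - y j) := by
  rw [laplacian, sub_mulVec, Pi.sub_apply, mulVec_diagonal]
  simp [mulVec, dotProduct, mul_sub, Finset.sum_sub_distrib, Finset.sum_mul]

theorem laplacian_mulVec_add_const (y : Fin N → ℝ) (c : ℝ) :
    G.laplacian *ᵥ (fun i => y i + c) = G.laplacian *ᵥ y := by
  ext i
  simp [laplacian_mulVec_apply]

variable {G}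

theorem WeightBalanced.sum_laplacian_mulVec (hG : G.WeightBalanced) (y : Fin N → ℝ) :
    ∑ i, (G.laplacian *ᵥ y) i = 0 := by
  simp only [laplacian_mulVec_apply, mul_sub, Finset.sum_sub_distrib]
  rw [Finset.sum_comm (f := fun i j => G.a i j * y j)]
  simp only [← Finset.sum_mul]
  simp [hG _]

theorem WeightBalanced.two_mul_dotProduct_laplacian (hG : G.WeightBalanced) (y : Fin N → ℝ) :
    2 * (y ⬝ᵥ (G.laplacian *ᵥ y)) = G.edgeEnergy y := by
  have h1 : ∑ i, ∑ j, G.a i j * y j ^ 2 = ∑ i, ∑ j, G.a i j * y i ^ 2 := by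
    rw [Finset.sum_comm]
    simp only [← Finset.sum_mul, hG _]
  have h2 : G.edgeEnergy y = ∑ i, ∑ j, 2 * (y i * (G.a i j * (y i - y j))) +
      (∑ i, ∑ j, G.a i j * y j ^ 2 - ∑ i, ∑ j, G.a i j * y i ^ 2) := by
    simp only [edgeEnergy, ← Finset.sum_add_distrib, ← Finset.sum_sub_distrib]
    exact Finset.sum_congr rfl fun i _ => Finset.sum_congr rfl fun j _ => by ring
  rw [h2, h1, sub_self, add_zero, dotProduct]
  simp only [laplacian_mulVec_apply, Finset.mul_sum]

variable (G)

theorem dotProduct_laplacian_mulVec_le (y : Fin N → ℝ) :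
    (G.laplacian *ᵥ y) ⬝ᵥ (G.laplacian *ᵥ y) ≤ (∑ i, ∑ j, G.a i j) * G.edgeEnergy y := by
  have h1 : ∀ i, (G.laplacian *ᵥ y) i * (G.laplacian *ᵥ y) i ≤
      (∑ i, ∑ j, G.a i j) * ∑ j, G.a i j * (y i - y j) ^ 2 := by
    intro i
    rw [laplacian_mulVec_apply, ← sq]
    have hcs := Finset.sum_sq_le_sum_mul_sum_of_sq_le_mul Finset.univ
      (r := fun j => G.a i j * (y i - y j)) (f := fun j => G.a i j)
      (g := fun j => G.a i j * (y i - y j) ^ 2) (fun j _ => G.a_nonneg i j)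
      (fun j _ => mul_nonneg (G.a_nonneg i j) (sq_nonneg _)) (fun j _ => le_of_eq (by ring))
    refine hcs.trans (mul_le_mul_of_nonneg_right ?_
      (Finset.sum_nonneg fun j _ => mul_nonneg (G.a_nonneg i j) (sq_nonneg _)))
    exact Finset.single_le_sum (f := fun i => ∑ j, G.a i j)
      (fun i _ => Finset.sum_nonneg fun j _ => G.a_nonneg i j) (Finset.mem_univ i)
  rw [dotProduct, edgeEnergy, Finset.mul_sum]
  exact Finset.sum_le_sum fun i _ => h1 i

/-- Finitely many weighted digraphs share a constant in the bound of `|L y|²` by the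
disagreement energy. -/
theorem exists_dotProduct_laplacian_le {m : ℕ} (G : Fin m → WeightedDigraph N) :
    ∃ M : ℝ, 0 ≤ M ∧ ∀ p y, ((G p).laplacian *ᵥ y) ⬝ᵥ ((G p).laplacian *ᵥ y) ≤
      M * (G p).edgeEnergy y := by
  have hnn : ∀ p, 0 ≤ ∑ i, ∑ j, (G p).a i j := fun p =>
    Finset.sum_nonneg fun i _ => Finset.sum_nonneg fun j _ => (G p).a_nonneg i j
  refine ⟨∑ p, ∑ i, ∑ j, (G p).a i j, Finset.sum_nonneg fun p _ => hnn p, fun p y => ?_⟩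
  refine ((G p).dotProduct_laplacian_mulVec_le y).trans
    (mul_le_mul_of_nonneg_right ?_ ((G p).edgeEnergy_nonneg y))
  exact Finset.single_le_sum (f := fun p => ∑ i, ∑ j, (G p).a i j)
    (fun p _ => hnn p) (Finset.mem_univ p)

/-- Finitely many weighted digraphs have a common positive lower bound on the weights of
their edges. -/
theorem exists_pos_le_weight {m : ℕ} (G : Fin m → WeightedDigraph N) :
    ∃ α : ℝ, 0 < α ∧ ∀ p i j, (G p).Adj i j → α ≤ (G p).a i j := by
  classical
  obtain ⟨α, hα, h⟩ : ∃ α : ℝ, 0 < α ∧ ∀ e : Fin m × Fin N × Fin N,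
      (G e.1).Adj e.2.1 e.2.2 → α ≤ (G e.1).a e.2.1 e.2.2 := by
    have hb : ∀ e : Fin m × Fin N × Fin N, ∃ b : ℝ, 0 < b ∧
        ((G e.1).Adj e.2.1 e.2.2 → b ≤ (G e.1).a e.2.1 e.2.2) := fun e => by
      by_cases he : (G e.1).Adj e.2.1 e.2.2
      · exact ⟨_, (G e.1).pos_of_adj _ _ he, fun _ => le_rfl⟩
      · exact ⟨1, one_pos, fun h => absurd h he⟩
    choose b hb0 hb1 using hb
    rcases isEmpty_or_nonempty (Fin m × Fin N × Fin N) with hE | hE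
    · exact ⟨1, one_pos, fun e => hE.elim e⟩
    · obtain ⟨e₀, he₀⟩ := Finite.exists_min b
      exact ⟨b e₀, hb0 e₀, fun e he => (he₀ e).trans (hb1 e he)⟩
  exact ⟨α, hα, fun p i j => h (p, i, j)⟩

end WeightedDigraph

/-! ### Spreading of edge bounds over a strongly connected digraph -/

/-- If a function varies by at most `c` along each edge, then it varies by at most `N * c` in
total, because two nodes are joined by a path with fewer than `N` edges. -/
theorem StronglyConnected.abs_sub_le {N : ℕ} {D : Digraph (Fin N)} (hD : StronglyConnected D)
    {y : Fin N → ℝ} {c : ℝ} (hc : 0 ≤ c) (h : ∀ i j, D.Adj i j → |y i - y j| ≤ c) (i j : Fin N) :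
    |y i - y j| ≤ N * c := by
  classical
  have hadj : ∀ i j, (SimpleGraph.fromRel D.Adj).Adj i j → |y i - y j| ≤ c := by
    rintro i j ⟨-, h' | h'⟩
    · exact h i j h'
    · rw [abs_sub_comm]
      exact h j i h'
  have hreach : (SimpleGraph.fromRel D.Adj).Reachable i j := by
    induction hD i j with
    | refl => exact SimpleGraph.Reachable.refl _
    | @tail k l _ hkl ih =>
      refine ih.trans ?_
      by_cases hne : k = l
      · exact hne ▸ SimpleGraph.Reachable.refl _
      · exact SimpleGraph.Adj.reachable ⟨hne, Or.inl hkl⟩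
  have hwalk : ∀ {i j : Fin N} (w : (SimpleGraph.fromRel D.Adj).Walk i j),
      |y i - y j| ≤ w.length * c := by
    intro i j w
    induction w with
    | nil => simp
    | @cons u v w huv _ ih =>
      have := hadj _ _ huv
      have h3 := _root_.abs_sub_le (y u) (y v) (y w)
      rw [SimpleGraph.Walk.length_cons]
      push_cast
      linarith
  obtain ⟨w, hw⟩ := hreach.exists_isPath
  have hlen : (w.length : ℝ) ≤ N := by
    have := hw.length_lt
    rw [Fintype.card_fin] at this
    exact_mod_cast this.le
  exact (hwalk w).trans (mul_le_mul_of_nonneg_right hlen hc)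

/-! ### Dissipation estimates -/

section Dissipation

variable {E : Type*} [NormedAddCommGroup E] [InnerProductSpace ℝ E] {z z' : ℝ → E} {a b : ℝ}

theorem norm_sq_le_sub_of_inner_le {c : ℝ} (hab : a ≤ b) (hc : ContinuousOn z (Set.Icc a b))
    (hz : ∀ t ∈ Set.Ico a b, HasDerivWithinAt z (z' t) (Set.Ici t) t)
    (hd : ∀ t ∈ Set.Ico a b, 2 * inner ℝ (z t) (z' t) ≤ -c) :
    ‖z b‖ ^ 2 ≤ ‖z a‖ ^ 2 - c * (b - a) := by
  refine image_le_of_deriv_right_le_deriv_boundary (f := fun t => ‖z t‖ ^ 2)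
    (f' := fun t => 2 * inner ℝ (z t) (z' t)) (B := fun t => ‖z a‖ ^ 2 - c * (t - a))
    (B' := fun _ => -c) (hc.norm.pow 2) (fun t ht => (hz t ht).norm_sq) (by simp) (by fun_prop)
    (fun t _ => ?_) hd (Set.right_mem_Icc.2 hab)
  have h := (((hasDerivAt_id t).sub_const a).const_mul c).const_sub (‖z a‖ ^ 2)
  simpa using h.hasDerivWithinAt

/-- If the squared speed is at most `M` times the rate at which the energy `‖z‖²` is dissipated,
then the displacement is controlled by the energy lost. The parameter `η` comes from Young's
inequality `‖z'‖ ≤ (η + ‖z'‖² / η) / 2`, which replaces the Cauchy-Schwarz inequality for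
integrals. -/
theorem norm_sub_le_of_dissipation {M η : ℝ} (hη : 0 < η) (hc : ContinuousOn z (Set.Icc a b))
    (hz : ∀ t ∈ Set.Ico a b, HasDerivWithinAt z (z' t) (Set.Ici t) t)
    (hd : ∀ t ∈ Set.Ico a b, ‖z' t‖ ^ 2 ≤ M * -(2 * inner ℝ (z t) (z' t)))
    {t : ℝ} (ht : t ∈ Set.Icc a b) :
    ‖z t - z a‖ ≤ (η * (t - a) + M / η * (‖z a‖ ^ 2 - ‖z t‖ ^ 2)) / 2 := by
  refine image_norm_le_of_norm_deriv_right_le_deriv_boundary' (f := fun t => z t - z a)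
    (f' := z') (B := fun t => (η * (t - a) + M / η * (‖z a‖ ^ 2 - ‖z t‖ ^ 2)) / 2)
    (B' := fun t => (η + M / η * -(2 * inner ℝ (z t) (z' t))) / 2)
    (hc.sub continuousOn_const) (fun t ht => (hz t ht).sub_const _) (by simp) ?_ ?_ ?_ ht
  · exact (((continuousOn_id.sub continuousOn_const).const_smul η).add
      ((continuousOn_const.sub (hc.norm.pow 2)).const_smul (M / η))).div_const 2
  · intro t ht
    have h1 := ((hasDerivAt_id t).sub_const a).const_mul η |>.hasDerivWithinAt (s := Set.Ici t)
    have h2 := ((hz t ht).norm_sq.const_sub (‖z a‖ ^ 2)).const_mul (M / η)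
    simpa using (h1.add h2).div_const 2
  · intro t ht
    have h1 : ‖z' t‖ ≤ (η + ‖z' t‖ ^ 2 / η) / 2 := by
      have h2 : (η + ‖z' t‖ ^ 2 / η) / 2 - ‖z' t‖ = (η - ‖z' t‖) ^ 2 / (2 * η) := by
        field_simp
        ring
      have h3 : 0 ≤ (η - ‖z' t‖) ^ 2 / (2 * η) := by positivity
      linarith
    have h4 : ‖z' t‖ ^ 2 / η ≤ M / η * -(2 * inner ℝ (z t) (z' t)) := by
      rw [div_mul_eq_mul_div]
      exact div_le_div_of_nonneg_right (hd t ht) hη.le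
    linarith

end Dissipation

/-! ### Transition matrices of piecewise constant linear systems -/

section Transition

theorem exists_mem_Ico_of_tendsto {t : ℕ → ℝ} (hlim : Tendsto t atTop atTop) {τ : ℝ}
    (hτ : t 0 ≤ τ) : ∃ k, τ ∈ Set.Ico (t k) (t (k + 1)) := by
  classical
  have hex : ∃ k, τ < t k := (hlim.eventually_gt_atTop τ).exists
  obtain ⟨k, hk⟩ := Nat.exists_eq_succ_of_ne_zero (n := Nat.find hex) fun h =>
    hτ.not_gt (h ▸ Nat.find_spec hex)
  refine ⟨k, not_lt.1 fun h => ?_, ?_⟩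
  · have := Nat.find_min' hex h
    omega
  · simpa [hk] using Nat.find_spec hex

variable {𝔸 : Type*} [NormedRing 𝔸] [NormedAlgebra ℝ 𝔸]

/-- The time spent in `[p, q]` up to time `τ`. -/
def elapsed (p q τ : ℝ) : ℝ := max 0 (min τ q - p)

/-- The transition matrix from time `t 0` to time `τ` of the system `X' = A X` that equals `a k` on
`[t k, t (k+1)]` for `k < n` and is at rest after `t n`. -/
noncomputable def switchedExp (t : ℕ → ℝ) (a : ℕ → 𝔸) : ℕ → ℝ → 𝔸
  | 0, _ => 1
  | n + 1, τ => NormedSpace.exp (elapsed (t n) (t (n + 1)) τ • a n) * switchedExp t a n τ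

/-- The inverse of `switchedExp`. -/
noncomputable def switchedExpInv (t : ℕ → ℝ) (a : ℕ → 𝔸) : ℕ → ℝ → 𝔸
  | 0, _ => 1
  | n + 1, τ => switchedExpInv t a n τ * NormedSpace.exp (elapsed (t n) (t (n + 1)) τ • -a n)

variable {t : ℕ → ℝ} {a : ℕ → 𝔸}

theorem continuous_elapsed (p q : ℝ) : Continuous (elapsed p q) := by
  unfold elapsed
  fun_prop

theorem elapsed_of_le {p q τ : ℝ} (h : τ ≤ p) : elapsed p q τ = 0 :=
  max_eq_left (sub_nonpos.2 ((min_le_left _ _).trans h))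

theorem elapsed_of_mem {p q τ : ℝ} (h : τ ∈ Set.Icc p q) : elapsed p q τ = τ - p := by
  rw [elapsed, min_eq_left h.2, max_eq_right (sub_nonneg.2 h.1)]

theorem elapsed_of_ge {p q τ : ℝ} (h : q ≤ τ) : elapsed p q τ = max 0 (q - p) := by
  rw [elapsed, min_eq_right h]

theorem switchedExp_eq_of_le (ht : Monotone t) {k n : ℕ} (hkn : k ≤ n) {τ : ℝ} (hτ : τ ≤ t k) :
    switchedExp t a n τ = switchedExp t a k τ ∧
      switchedExpInv t a n τ = switchedExpInv t a k τ := by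
  induction n, hkn using Nat.le_induction with
  | base => exact ⟨rfl, rfl⟩
  | succ n hkn ih =>
    simp [switchedExp, switchedExpInv, elapsed_of_le (hτ.trans (ht hkn)), ih]

theorem switchedExp_eq_of_ge (ht : Monotone t) {n : ℕ} {τ : ℝ} (hτ : t n ≤ τ) :
    switchedExp t a n τ = switchedExp t a n (t n) ∧
      switchedExpInv t a n τ = switchedExpInv t a n (t n) := by
  suffices h : ∀ k ≤ n, switchedExp t a k τ = switchedExp t a k (t n) ∧
      switchedExpInv t a k τ = switchedExpInv t a k (t n) from h n le_rfl
  intro k hk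
  induction k with
  | zero => exact ⟨rfl, rfl⟩
  | succ k ih =>
    obtain ⟨h1, h2⟩ := ih (by omega)
    simp only [switchedExp, switchedExpInv, h1, h2, elapsed_of_ge ((ht hk).trans hτ),
      elapsed_of_ge (ht hk), and_self]

variable [CompleteSpace 𝔸]

theorem exp_smul_mul_exp_smul_neg (s : ℝ) (x : 𝔸) :
    NormedSpace.exp (s • x) * NormedSpace.exp (s • -x) = 1 ∧
      NormedSpace.exp (s • -x) * NormedSpace.exp (s • x) = 1 := by
  let _ : NormedAlgebra ℚ 𝔸 := .restrictScalars ℚ ℝ 𝔸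
  rw [smul_neg]
  have hc : Commute (s • x) (-(s • x)) := (Commute.refl _).neg_right
  rw [← NormedSpace.exp_add_of_commute hc, ← NormedSpace.exp_add_of_commute hc.symm]
  simp

theorem continuous_switchedExp (n : ℕ) :
    Continuous (switchedExp t a n) ∧ Continuous (switchedExpInv t a n) := by
  let _ : NormedAlgebra ℚ 𝔸 := .restrictScalars ℚ ℝ 𝔸
  induction n with
  | zero => exact ⟨continuous_const, continuous_const⟩
  | succ n ih =>
    have he := continuous_elapsed (t n) (t (n + 1))
    exact ⟨(NormedSpace.exp_continuous.comp (he.smul continuous_const)).mul ih.1,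
      ih.2.mul (NormedSpace.exp_continuous.comp (he.smul continuous_const))⟩

theorem switchedExp_mul_inv (n : ℕ) (τ : ℝ) :
    switchedExp t a n τ * switchedExpInv t a n τ = 1 ∧
      switchedExpInv t a n τ * switchedExp t a n τ = 1 := by
  induction n with
  | zero => simp [switchedExp, switchedExpInv]
  | succ n ih =>
    obtain ⟨h1, h2⟩ := exp_smul_mul_exp_smul_neg (elapsed (t n) (t (n + 1)) τ) (a n)
    simp only [switchedExp, switchedExpInv]
    constructor
    · rw [mul_assoc, ← mul_assoc (switchedExp t a n τ), ih.1, one_mul, h1]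
    · rw [mul_assoc, ← mul_assoc (NormedSpace.exp _), h2, one_mul, ih.2]

theorem hasDerivWithinAt_switchedExp (ht : Monotone t) {k : ℕ} {τ : ℝ}
    (hτ : τ ∈ Set.Ico (t k) (t (k + 1))) :
    HasDerivWithinAt (switchedExp t a (k + 1)) (a k * switchedExp t a (k + 1) τ) (Set.Ici τ) τ ∧
      HasDerivWithinAt (switchedExpInv t a (k + 1)) (-(switchedExpInv t a (k + 1) τ * a k))
        (Set.Ici τ) τ := by
  have hev : ∀ᶠ s in 𝓝[≥] τ, s ∈ Set.Icc (t k) (t (k + 1)) := by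
    filter_upwards [Icc_mem_nhdsGE hτ.2] with s hs using ⟨hτ.1.trans hs.1, hs.2⟩
  have hform : ∀ s ∈ Set.Icc (t k) (t (k + 1)),
      switchedExp t a (k + 1) s = NormedSpace.exp ((s - t k) • a k) * switchedExp t a k (t k) ∧
      switchedExpInv t a (k + 1) s =
        switchedExpInv t a k (t k) * NormedSpace.exp ((s - t k) • -a k) := by
    intro s hs
    simp only [switchedExp, switchedExpInv, elapsed_of_mem hs,
      (switchedExp_eq_of_ge (a := a) ht hs.1).1, (switchedExp_eq_of_ge (a := a) ht hs.1).2,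
      and_self]
  have hτ' : τ ∈ Set.Icc (t k) (t (k + 1)) := ⟨hτ.1, hτ.2.le⟩
  have hd : ∀ x : 𝔸, HasDerivAt (fun s : ℝ => NormedSpace.exp ((s - t k) • x))
      (x * NormedSpace.exp ((τ - t k) • x)) τ := fun x =>
    (hasDerivAt_exp_smul_const' x (τ - t k)).comp_sub_const τ (t k)
  have hd' : ∀ x : 𝔸, HasDerivAt (fun s : ℝ => NormedSpace.exp ((s - t k) • x))
      (NormedSpace.exp ((τ - t k) • x) * x) τ := fun x =>
    (hasDerivAt_exp_smul_const x (τ - t k)).comp_sub_const τ (t k)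
  constructor
  · have h := ((hd (a k)).mul_const (switchedExp t a k (t k))).hasDerivWithinAt (s := Set.Ici τ)
    rw [mul_assoc, ← (hform τ hτ').1] at h
    exact h.congr_of_eventuallyEq (hev.mono fun s hs => (hform s hs).1) (hform τ hτ').1
  · have h := ((hd' (-a k)).const_mul (switchedExpInv t a k (t k))).hasDerivWithinAt
      (s := Set.Ici τ)
    rw [← mul_assoc, ← (hform τ hτ').2, mul_neg] at h
    exact h.congr_of_eventuallyEq (hev.mono fun s hs => (hform s hs).2) (hform τ hτ').2

/-- Existence of a fundamental solution `X` of `X' = A X`, together with its inverse `Y`, for a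
piecewise constant right-continuous coefficient `A` whose switching times tend to infinity. -/
theorem exists_fundamental_solution {A : ℝ → 𝔸} (ht : StrictMono t) (hlim : Tendsto t atTop atTop)
    (hA : ∀ k, ∀ τ ∈ Set.Ico (t k) (t (k + 1)), A τ = A (t k)) :
    ∃ X Y : ℝ → 𝔸, Continuous X ∧ Continuous Y ∧ (∀ τ, X τ * Y τ = 1) ∧ (∀ τ, Y τ * X τ = 1) ∧
      ∀ τ, t 0 ≤ τ → HasDerivWithinAt X (A τ * X τ) (Set.Ici τ) τ ∧
        HasDerivWithinAt Y (-(Y τ * A τ)) (Set.Ici τ) τ := by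
  have hex : ∀ τ : ℝ, ∃ n, τ < t n := fun τ => (hlim.eventually_gt_atTop τ).exists
  choose n hn using hex
  let a : ℕ → 𝔸 := fun k => A (t k)
  let X : ℝ → 𝔸 := fun τ => switchedExp t a (n τ) τ
  let Y : ℝ → 𝔸 := fun τ => switchedExpInv t a (n τ) τ
  -- The values do not depend on how many switching intervals beyond `τ` are taken into account.
  have heq : ∀ k τ, τ ≤ t k → X τ = switchedExp t a k τ ∧ Y τ = switchedExpInv t a k τ := by
    intro k τ hk
    rcases le_total k (n τ) with h | h
    · exact switchedExp_eq_of_le ht.monotone h hk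
    · have := switchedExp_eq_of_le (a := a) ht.monotone h (hn τ).le
      exact ⟨this.1.symm, this.2.symm⟩
  refine ⟨X, Y, ?_, ?_, fun τ => (switchedExp_mul_inv _ _).1, fun τ => (switchedExp_mul_inv _ _).2,
    fun τ hτ => ?_⟩
  · refine continuous_iff_continuousAt.2 fun τ => ?_
    refine (continuous_switchedExp (t := t) (a := a) (n τ)).1.continuousAt.congr ?_
    filter_upwards [Iio_mem_nhds (hn τ)] with s hs using (heq _ s (le_of_lt hs)).1.symm
  · refine continuous_iff_continuousAt.2 fun τ => ?_
    refine (continuous_switchedExp (t := t) (a := a) (n τ)).2.continuousAt.congr ?_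
    filter_upwards [Iio_mem_nhds (hn τ)] with s hs using (heq _ s (le_of_lt hs)).2.symm
  · obtain ⟨k, hk⟩ : ∃ k, τ ∈ Set.Ico (t k) (t (k + 1)) :=
      exists_mem_Ico_of_tendsto hlim hτ
    have hev : ∀ᶠ s in 𝓝[≥] τ, s ≤ t (k + 1) := by
      filter_upwards [Icc_mem_nhdsGE hk.2] with s hs using hs.2
    obtain ⟨hX, hY⟩ := hasDerivWithinAt_switchedExp (a := a) ht.monotone hk
    have hτk := heq (k + 1) τ hk.2.le
    rw [hA k τ hk, hτk.1, hτk.2]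
    exact ⟨hX.congr_of_eventuallyEq (hev.mono fun s hs => (heq _ s hs).1) hτk.1,
      hY.congr_of_eventuallyEq (hev.mono fun s hs => (heq _ s hs).2) hτk.2⟩

end Transition

/-! ### Exponential stability of the switched reduced Laplacian dynamics -/

section ExponentialBound

open Matrix

variable {N m : ℕ} {R : Matrix (Fin N) (Fin (N - 1)) ℝ} {G : Fin m → WeightedDigraph N}
  {σ : ℝ → Fin m} {t₀ : ℝ}

theorem two_mul_inner_reducedLaplacian {D : WeightedDigraph N} (hD : D.WeightBalanced)
    (v : EuclideanSpace ℝ (Fin (N - 1))) :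
    2 * inner ℝ v (-(toEuclideanCLM (𝕜 := ℝ) (Rᵀ * D.laplacian * R) v)) =
      -D.edgeEnergy (R *ᵥ v) := by
  rw [inner_neg_right, inner_toEuclideanCLM, ← hD.two_mul_dotProduct_laplacian, Matrix.mul_assoc,
    ← mulVec_mulVec, dotProduct_mulVec, ← mulVec_transpose, transpose_transpose, ← mulVec_mulVec,
    mul_neg]

theorem norm_reducedLaplacian_sq_le (hR : IsDisagreementBasis R) (D : WeightedDigraph N)
    (v : EuclideanSpace ℝ (Fin (N - 1))) :
    ‖-(toEuclideanCLM (𝕜 := ℝ) (Rᵀ * D.laplacian * R) v)‖ ^ 2 ≤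
      (D.laplacian *ᵥ (R *ᵥ v)) ⬝ᵥ (D.laplacian *ᵥ (R *ᵥ v)) := by
  have h : toEuclideanCLM (𝕜 := ℝ) (Rᵀ * D.laplacian * R) v =
      WithLp.toLp 2 (Rᵀ *ᵥ (D.laplacian *ᵥ (R *ᵥ v))) := by
    rw [mulVec_mulVec, mulVec_mulVec]
    rfl
  rw [norm_neg, h, norm_toLp_sq]
  exact hR.dotProduct_transpose_mulVec_le _

/-- Uniform contraction over a time interval of length at most `B` on which the union of the
active digraphs is strongly connected and each of them is active for at least `tL`. If the energy
lost were small, then the state would hardly move, hence be almost in agreement along each edge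
of the union at the initial time, hence be small. -/
theorem exists_contraction (hR : IsDisagreementBasis R) (G : Fin m → WeightedDigraph N)
    {B tL : ℝ} (hB : 0 ≤ B) (htL : 0 < tL) :
    ∃ δ : ℝ, 0 < δ ∧ δ < 1 ∧ ∀ (σ : ℝ → Fin m) (a b : ℝ) (z : ℝ → EuclideanSpace ℝ (Fin (N - 1))),
      a ≤ b → b - a ≤ B → (∀ τ ∈ Set.Ico a b, (G (σ τ)).WeightBalanced) →
      (∀ τ ∈ Set.Ico a b, ∃ p q, a ≤ p ∧ q ≤ b ∧ tL ≤ q - p ∧ ∀ s ∈ Set.Ico p q, σ s = σ τ) →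
      StronglyConnected (⨆ τ ∈ Set.Ico a b, (G (σ τ)).toDigraph) →
      IsReducedSolution G σ R a z → ‖z b‖ ≤ δ * ‖z a‖ := by
  obtain ⟨M, hM, hMle⟩ := WeightedDigraph.exists_dotProduct_laplacian_le G
  obtain ⟨α, hα, hαle⟩ := WeightedDigraph.exists_pos_le_weight G
  have hs : 0 < √(α * tL) := Real.sqrt_pos.2 (mul_pos hα htL)
  -- `θ * ‖z a‖` is the scale of the deviations, `C * θ * ‖z a‖` bounds the differences along edges.
  set C : ℝ := 2 * (B + M) + 1 / √(α * tL) with hC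
  have hC0 : 0 < C := by positivity
  set θ : ℝ := 1 / (2 * (N * (N * C) + 1)) with hθ
  have hθ0 : 0 < θ := by positivity
  have hθ1 : θ ≤ 1 / 2 := by
    rw [hθ]
    apply one_div_le_one_div_of_le two_pos
    have : 0 ≤ (N : ℝ) * (N * C) := by positivity
    linarith
  have hθC : N * (N * (C * θ)) < 1 := by
    have h1 : 0 ≤ (N : ℝ) * (N * C) := by positivity
    have h2 : N * (N * (C * θ)) = (N * (N * C)) / (2 * (N * (N * C) + 1)) := by
      rw [hθ]; ring
    rw [h2, div_lt_one (by linarith)]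
    linarith
  have hδ : 0 < 1 - θ ^ 2 := by nlinarith
  refine ⟨√(1 - θ ^ 2), Real.sqrt_pos.2 hδ, ?_, ?_⟩
  · rw [Real.sqrt_lt' one_pos]
    nlinarith [pow_pos hθ0 2]
  intro σ a b z hab hbaB hbal hact hconn hz
  by_contra! hlt
  have hzc : ContinuousOn z (Set.Icc a b) := hz.1.mono Set.Icc_subset_Ici_self
  have hzd := fun t (ht : t ∈ Set.Ico a b) => hz.2 t ht.1
  have hmono : ∀ {p q c : ℝ}, a ≤ p → p ≤ q → q ≤ b →
      (∀ t ∈ Set.Ico p q, c ≤ (G (σ t)).edgeEnergy (R *ᵥ z t)) →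
      ‖z q‖ ^ 2 ≤ ‖z p‖ ^ 2 - c * (q - p) := by
    intro p q c hp hpq hq hc
    refine norm_sq_le_sub_of_inner_le hpq (hzc.mono (Set.Icc_subset_Icc hp hq))
      (fun t ht => hzd t ⟨hp.trans ht.1, ht.2.trans_le hq⟩) fun t ht => ?_
    rw [two_mul_inner_reducedLaplacian (hbal t ⟨hp.trans ht.1, ht.2.trans_le hq⟩)]
    exact neg_le_neg (hc t ht)
  have hdec : ∀ {p q : ℝ}, a ≤ p → p ≤ q → q ≤ b → ‖z q‖ ^ 2 ≤ ‖z p‖ ^ 2 := by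
    intro p q hp hpq hq
    simpa using hmono (c := 0) hp hpq hq fun t _ => WeightedDigraph.edgeEnergy_nonneg _ _
  have hr : 0 < ‖z a‖ := by
    refine (norm_nonneg _).lt_of_ne fun h0 => ?_
    have h1 := hdec le_rfl hab le_rfl
    rw [← h0] at h1 hlt
    rw [mul_zero] at hlt
    nlinarith [pow_pos hlt 2]
  set η : ℝ := θ * ‖z a‖ with hη
  have hη0 : 0 < η := mul_pos hθ0 hr
  have hloss : ‖z a‖ ^ 2 - ‖z b‖ ^ 2 < η ^ 2 := by
    have h1 := mul_self_lt_mul_self (by positivity) hlt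
    have h2 : √(1 - θ ^ 2) * ‖z a‖ * (√(1 - θ ^ 2) * ‖z a‖) = (1 - θ ^ 2) * ‖z a‖ ^ 2 := by
      rw [mul_mul_mul_comm, Real.mul_self_sqrt hδ.le, sq ‖z a‖]
    rw [h2] at h1
    rw [hη]
    nlinarith
  have hdrift : ∀ t ∈ Set.Icc a b, ‖z t - z a‖ ≤ (B + M) * η / 2 := by
    intro t ht
    have h1 := norm_sub_le_of_dissipation (M := M) hη0 hzc hzd (fun s hs => ?_) ht
    · have h2 : η * (t - a) ≤ η * B := mul_le_mul_of_nonneg_left (by linarith [ht.2]) hη0.le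
      have h3 : M / η * (‖z a‖ ^ 2 - ‖z t‖ ^ 2) ≤ M / η * η ^ 2 :=
        mul_le_mul_of_nonneg_left (by linarith [hdec ht.1 ht.2 le_rfl]) (by positivity)
      have h4 : M / η * η ^ 2 = M * η := by field_simp
      linarith
    · rw [two_mul_inner_reducedLaplacian (hbal s hs), neg_neg]
      exact (norm_reducedLaplacian_sq_le hR _ _).trans (hMle _ _)
  have hedge : ∀ i j, (⨆ τ ∈ Set.Ico a b, (G (σ τ)).toDigraph).Adj i j →
      |(R *ᵥ z a) i - (R *ᵥ z a) j| ≤ C * η := by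
    intro i j hij
    obtain ⟨τ, hτ, hadj⟩ : ∃ τ ∈ Set.Ico a b, (G (σ τ)).Adj i j := by
      simpa using hij
    obtain ⟨p, q, hap, hqb, hpq, hσ⟩ := hact τ hτ
    by_contra! hbig
    have hfar : ∀ t ∈ Set.Icc a b, η / √(α * tL) ≤ |(R *ᵥ z t) i - (R *ᵥ z t) j| := by
      intro t ht
      have h1 := hR.abs_sub_le (z t - z a) i j
      rw [WithLp.ofLp_sub, mulVec_sub] at h1
      have h2 : |(R *ᵥ z a) i - (R *ᵥ z a) j| ≤ |(R *ᵥ z t) i - (R *ᵥ z t) j| +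
          |(R *ᵥ z t - R *ᵥ z a) i - (R *ᵥ z t - R *ᵥ z a) j| := by
        have := _root_.abs_sub ((R *ᵥ z t) i - (R *ᵥ z t) j)
          ((R *ᵥ z t - R *ᵥ z a) i - (R *ᵥ z t - R *ᵥ z a) j)
        refine le_trans (le_of_eq ?_) this
        congr 1
        simp only [Pi.sub_apply]
        ring
      have h3 : C * η = 2 * ((B + M) * η) + η / √(α * tL) := by
        rw [hC]
        ring
      have h4 : 0 ≤ (B + M) * η := by positivity
      linarith [hdrift t ht]
    have h5 : ∀ t ∈ Set.Ico p q, η ^ 2 / tL ≤ (G (σ t)).edgeEnergy (R *ᵥ z t) := by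
      intro t ht
      refine le_trans ?_ (WeightedDigraph.le_edgeEnergy _ _ i j)
      have h6 := hfar t ⟨hap.trans ht.1, ht.2.le.trans hqb⟩
      have h7 : (η / √(α * tL)) ^ 2 ≤ ((R *ᵥ z t) i - (R *ᵥ z t) j) ^ 2 :=
        sq_le_sq.2 (by rwa [abs_of_pos (div_pos hη0 hs)])
      rw [div_pow, Real.sq_sqrt (by positivity)] at h7
      rw [hσ t ht]
      calc η ^ 2 / tL = α * (η ^ 2 / (α * tL)) := by field_simp
        _ ≤ _ := mul_le_mul (hαle _ _ _ hadj) h7 (by positivity)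
            (WeightedDigraph.a_nonneg _ _ _)
    have hpq' : p ≤ q := by linarith
    have h8 := hmono hap hpq' hqb h5
    have h9 : η ^ 2 ≤ η ^ 2 / tL * (q - p) := by
      rw [div_mul_eq_mul_div, le_div_iff₀ htL]
      exact mul_le_mul_of_nonneg_left hpq (sq_nonneg _)
    linarith [hdec le_rfl hap (hpq'.trans hqb), hdec (hap.trans hpq') hqb le_rfl]
  have hsmall := hR.norm_le_of_abs_sub_le (z a)
    (hconn.abs_sub_le (by positivity) hedge)
  have h1 : (N : ℝ) * (N * (C * η)) = N * (N * (C * θ)) * ‖z a‖ := by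
    rw [hη]
    ring
  rw [h1] at hsmall
  nlinarith

theorem IsReducedSolution.mono {s s' : ℝ} {z : ℝ → EuclideanSpace ℝ (Fin (N - 1))}
    (hz : IsReducedSolution G σ R s z) (h : s ≤ s') : IsReducedSolution G σ R s' z :=
  ⟨hz.1.mono (Set.Ici_subset_Ici.2 h), fun t ht => hz.2 t (h.trans ht)⟩

theorem IsReducedSolution.antitoneOn_norm (hbal : ∀ τ, t₀ ≤ τ → (G (σ τ)).WeightBalanced)
    {z : ℝ → EuclideanSpace ℝ (Fin (N - 1))} (hz : IsReducedSolution G σ R t₀ z) :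
    AntitoneOn (fun t => ‖z t‖) (Set.Ici t₀) := by
  intro p hp q _ hpq
  have h := norm_sq_le_sub_of_inner_le (c := 0) hpq
    (hz.1.mono (Set.Icc_subset_Ici_self.trans (Set.Ici_subset_Ici.2 hp)))
    (fun t ht => hz.2 t (le_trans hp ht.1)) fun t ht => by
      rw [two_mul_inner_reducedLaplacian (hbal t (le_trans hp ht.1))]
      exact neg_le_neg (WeightedDigraph.edgeEnergy_nonneg _ _)
  exact abs_le_of_sq_le_sq' (by simpa using h) (norm_nonneg _) |>.2

/-- The switching times of a signal with a dwell time are increasing and tend to infinity. -/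
theorem strictMono_tendsto_of_dwell {t : ℕ → ℝ} {tL : ℝ} (htL : 0 < tL)
    (h : ∀ k, tL < t (k + 1) - t k) : StrictMono t ∧ Tendsto t atTop atTop := by
  refine ⟨strictMono_nat_of_lt_succ fun k => by linarith [h k], ?_⟩
  have hle : ∀ k : ℕ, t 0 + k * tL ≤ t k := by
    intro k
    induction k with
    | zero => simp
    | succ k ih => push_cast; linarith [h k]
  exact tendsto_atTop_mono hle
    (tendsto_atTop_add_const_left _ _ (tendsto_natCast_atTop_atTop.atTop_mul_const htL))

/-- A contraction by a fixed factor over every time span `P` gives exponential decay. -/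
theorem exp_decay_of_contraction {f : ℝ → ℝ} {s P δ : ℝ} (hP : 0 < P) (hδ : 0 < δ) (hδ1 : δ < 1)
    (hf0 : ∀ t, 0 ≤ f t) (hanti : AntitoneOn f (Set.Ici s))
    (hstep : ∀ t, s ≤ t → f (t + P) ≤ δ * f t) {t : ℝ} (ht : s ≤ t) :
    f t ≤ δ⁻¹ * Real.exp (-(-Real.log δ / P) * (t - s)) * f s := by
  have hiter : ∀ n : ℕ, f (s + n * P) ≤ δ ^ n * f s := by
    intro n
    induction n with
    | zero => simp
    | succ n ih =>
      have h1 := hstep (s + n * P) (by nlinarith [(Nat.cast_nonneg n : (0 : ℝ) ≤ n)])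
      have h2 : s + ((n + 1 : ℕ) : ℝ) * P = s + n * P + P := by push_cast; ring
      rw [h2, pow_succ']
      nlinarith
  set n := ⌊(t - s) / P⌋₊ with hn
  have hn1 : (n : ℝ) * P ≤ t - s :=
    (le_div_iff₀ hP).1 (Nat.floor_le (div_nonneg (sub_nonneg.2 ht) hP.le))
  have hn2 : (t - s) / P < n + 1 := Nat.lt_floor_add_one _
  have h1 : f t ≤ δ ^ n * f s := by
    refine (hanti ?_ (Set.mem_Ici.2 ht) (by linarith)).trans (hiter n)
    exact Set.mem_Ici.2 (by nlinarith [(Nat.cast_nonneg n : (0 : ℝ) ≤ n)])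
  refine h1.trans (mul_le_mul_of_nonneg_right ?_ (hf0 s))
  have h2 : Real.exp (-(-Real.log δ / P) * (t - s)) = δ ^ ((t - s) / P) := by
    rw [Real.rpow_def_of_pos hδ]
    congr 1
    ring
  have h3 : δ ^ n = δ⁻¹ * δ ^ ((n : ℝ) + 1) := by
    rw [Real.rpow_add hδ, Real.rpow_one, Real.rpow_natCast]
    field_simp
  rw [h2, h3]
  exact mul_le_mul_of_nonneg_left (Real.rpow_le_rpow_of_exponent_ge hδ hδ1.le hn2.le)
    (inv_nonneg.2 hδ.le)

theorem exists_uniformExpBound (hσ : IsAdmissible G σ t₀) (hR : IsDisagreementBasis R) :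
    ∃ κ lam : ℝ, 1 ≤ κ ∧ 0 < lam ∧ UniformExpBound G σ t₀ R κ lam := by
  obtain ⟨t, ht0, ⟨tL, htL, hdwell⟩, hconst, hbal, n, hn0, hn, ⟨B, hB⟩, hconn⟩ := hσ
  obtain ⟨htmono, htlim⟩ := strictMono_tendsto_of_dwell htL hdwell
  have htn : StrictMono fun j => t (n j) := htmono.comp hn
  have htn0 : ∀ j, t₀ ≤ t (n j) := fun j => by
    rw [← ht0]
    exact htmono.monotone (Nat.zero_le _)
  have hBpos : 0 < B := (sub_pos.2 (htn (Nat.lt_succ_self 0))).trans_le (hB 0)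
  obtain ⟨δ, hδ, hδ1, hcontr⟩ := exists_contraction hR G hBpos.le htL
  have hact : ∀ j, ∀ τ ∈ Set.Ico (t (n j)) (t (n (j + 1))), ∃ p q, t (n j) ≤ p ∧
      q ≤ t (n (j + 1)) ∧ tL ≤ q - p ∧ ∀ s ∈ Set.Ico p q, σ s = σ τ := by
    intro j τ hτ
    obtain ⟨k, hk⟩ := exists_mem_Ico_of_tendsto htlim (ht0.trans_le ((htn0 j).trans hτ.1))
    have h1 : n j ≤ k := Nat.lt_succ_iff.1 (htmono.lt_iff_lt.1 (hτ.1.trans_lt hk.2))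
    have h2 : k < n (j + 1) := htmono.lt_iff_lt.1 (hk.1.trans_lt hτ.2)
    exact ⟨t k, t (k + 1), htmono.monotone h1, htmono.monotone h2, (hdwell k).le,
      fun s hs => (hconst k s hs).trans (hconst k τ hk).symm⟩
  have hint : ∀ j z, IsReducedSolution G σ R (t (n j)) z →
      ‖z (t (n (j + 1)))‖ ≤ δ * ‖z (t (n j))‖ := fun j z hz =>
    hcontr σ _ _ z (htn (Nat.lt_succ_self j)).le (hB j) (fun τ hτ => hbal τ ((htn0 j).trans hτ.1))
      (hact j) (hconn j) hz
  refine ⟨δ⁻¹, -Real.log δ / (2 * B), (one_le_inv₀ hδ).2 hδ1.le,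
    div_pos (neg_pos.2 (Real.log_neg hδ hδ1)) (by linarith), fun s hs z hz τ hτ => ?_⟩
  have hanti := hz.antitoneOn_norm fun τ hτ => hbal τ (hs.trans hτ)
  refine exp_decay_of_contraction (f := fun t => ‖z t‖) (by linarith) hδ hδ1
    (fun _ => norm_nonneg _) hanti (fun r hr => ?_) hτ
  -- `[r, r + 2 B]` contains one of the intervals of joint strong connectivity.
  obtain ⟨j, hj1, hj2⟩ : ∃ j, r ≤ t (n j) ∧ t (n j) ≤ r + B := by
    obtain ⟨j, hj⟩ := exists_mem_Ico_of_tendsto (htlim.comp hn.tendsto_atTop) (τ := r)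
      (by simpa [hn0, ht0] using hs.trans hr)
    have hj1 : t (n j) ≤ r := hj.1
    exact ⟨j + 1, hj.2.le, by linarith [hB j]⟩
  have hsj : s ≤ t (n j) := hr.trans hj1
  have hj3 : t (n (j + 1)) ≤ r + 2 * B := by linarith [hB j]
  have hjj := (htn (Nat.lt_succ_self j)).le
  calc ‖z (r + 2 * B)‖ ≤ ‖z (t (n (j + 1)))‖ :=
        hanti (hsj.trans hjj) (by simp only [Set.mem_Ici]; linarith) hj3
    _ ≤ δ * ‖z (t (n j))‖ := hint j z (hz.mono hsj)
    _ ≤ δ * ‖z r‖ := mul_le_mul_of_nonneg_left (hanti hr hsj hj1) hδ.le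

end ExponentialBound

/-! ### Input-to-state bound -/

section InputToState

open Matrix

variable {N m : ℕ} {R : Matrix (Fin N) (Fin (N - 1)) ℝ} {G : Fin m → WeightedDigraph N}
  {σ : ℝ → Fin m} {t₀ κ lam : ℝ}

/-- The response of the reduced dynamics to an input `b` bounded by `g`. With the transition matrix
`Φ`, the function `τ ↦ Φ(T, τ) (z τ)` has right derivative `Φ(T, τ) (b τ)`, which is bounded by
`κ g exp (-lam (T - τ))`. The mean value inequality for right derivatives then plays the role of the
variation of constants formula, so that `b` need not be integrable. -/
theorem UniformExpBound.norm_le (hσ : IsAdmissible G σ t₀) (hκ : 0 ≤ κ) (hlam : 0 < lam)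
    (hb : UniformExpBound G σ t₀ R κ lam) {s T g : ℝ} (hs : t₀ ≤ s) (hsT : s ≤ T)
    {z b : ℝ → EuclideanSpace ℝ (Fin (N - 1))} (hzc : ContinuousOn z (Set.Ici s))
    (hz : ∀ t, s ≤ t → HasDerivWithinAt z
      (-(toEuclideanCLM (𝕜 := ℝ) (Rᵀ * (G (σ t)).laplacian * R) (z t)) + b t) (Set.Ici t) t)
    (hg : ∀ t, s ≤ t → ‖b t‖ ≤ g) :
    ‖z T‖ ≤ κ * Real.exp (-lam * (T - s)) * ‖z s‖ + κ * g / lam := by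
  obtain ⟨t, ht0, ⟨tL, htL, hdwell⟩, hconst, -⟩ := hσ
  obtain ⟨htmono, htlim⟩ := strictMono_tendsto_of_dwell htL hdwell
  obtain ⟨X, Y, hXc, hYc, hXY, -, hXYd⟩ := exists_fundamental_solution
    (A := fun τ => -toEuclideanCLM (n := Fin (N - 1)) (𝕜 := ℝ) (Rᵀ * (G (σ τ)).laplacian * R))
    htmono htlim (fun k τ hτ => by simp only [hconst k τ hτ])
  rw [ht0] at hXYd
  have hΦ : ∀ τ, t₀ ≤ τ → τ ≤ T → ∀ v, ‖X T (Y τ v)‖ ≤ κ * Real.exp (-lam * (T - τ)) * ‖v‖ := by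
    intro τ hτ hτT v
    have hsol : IsReducedSolution G σ R τ fun r => X r (Y τ v) := by
      refine ⟨(hXc.clm_apply continuous_const).continuousOn, fun r hr => ?_⟩
      have h := (hXYd r (hτ.trans hr)).1.clm_apply (hasDerivWithinAt_const r _ (Y τ v))
      simpa using h
    have h := hb τ hτ _ hsol T hτT
    have h1 : X τ (Y τ v) = v := by
      rw [← mul_apply_eq_comp, hXY, one_apply_eq_self]
    rwa [h1] at h
  have hg0 : 0 ≤ g := (norm_nonneg _).trans (hg s le_rfl)
  set w : ℝ → EuclideanSpace ℝ (Fin (N - 1)) := fun τ => X T (Y τ (z τ)) with hw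
  have hwd : ∀ τ ∈ Set.Ico s T, HasDerivWithinAt w (X T (Y τ (b τ))) (Set.Ici τ) τ := by
    intro τ hτ
    have h := (X T).hasFDerivAt.comp_hasDerivWithinAt τ
      ((hXYd τ (hs.trans hτ.1)).2.clm_apply (hz τ hτ.1))
    simp only [_root_.neg_apply, mul_apply_eq_comp, map_neg, neg_neg, map_add,
      add_neg_cancel_left] at h
    exact h
  have hwc : ContinuousOn w (Set.Icc s T) :=
    (X T).continuous.comp_continuousOn
      (hYc.continuousOn.clm_apply (hzc.mono Set.Icc_subset_Ici_self))
  have hmv := image_norm_le_of_norm_deriv_right_le_deriv_boundary (f := fun τ => w τ - w s)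
    (f' := fun τ => X T (Y τ (b τ)))
    (B := fun τ => κ * g / lam * (Real.exp (-lam * (T - τ)) - Real.exp (-lam * (T - s))))
    (B' := fun τ => κ * Real.exp (-lam * (T - τ)) * g)
    (hwc.sub continuousOn_const) (fun τ hτ => (hwd τ hτ).sub_const _) (by simp)
    (fun τ => by
      have h1 : HasDerivAt (fun τ : ℝ => -lam * (T - τ)) lam τ := by
        simpa using ((hasDerivAt_id τ).const_sub T).const_mul (-lam)
      exact ((h1.exp.sub_const (Real.exp (-lam * (T - s)))).const_mul (κ * g / lam)).congr_deriv
        (by field_simp))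
    (fun τ hτ => (hΦ τ (hs.trans hτ.1) hτ.2.le _).trans
      (mul_le_mul_of_nonneg_left (hg τ hτ.1) (by positivity)))
    (Set.right_mem_Icc.2 hsT)
  have hwT : w T = z T := by
    simp only [hw]
    rw [← mul_apply_eq_comp, hXY, one_apply_eq_self]
  have h1 : κ * g / lam * (Real.exp (-lam * (T - T)) - Real.exp (-lam * (T - s))) ≤
      κ * g / lam := by
    have h2 : 0 ≤ κ * g / lam := by positivity
    have h3 := (Real.exp_pos (-lam * (T - s))).le
    simp only [sub_self, mul_zero, Real.exp_zero]
    nlinarith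
  have h2 := hΦ s hs hsT (z s)
  have h3 := norm_add_le (w T - w s) (w s)
  rw [sub_add_cancel, hwT] at h3
  simp only [hwT] at hmv
  linarith

end InputToState

/-! ### Dynamic average consensus -/

section Consensus

open Matrix

variable {N m : ℕ} {R : Matrix (Fin N) (Fin (N - 1)) ℝ} {G : Fin m → WeightedDigraph N}
  {σ : ℝ → Fin m} {t₀ κ lam : ℝ} {u du x : Fin N → ℝ → ℝ}

theorem disagreement_le_gammaSup (hbdd : BddAbove (disagreement du '' Set.Ici t₀)) {s t : ℝ}
    (hs : t₀ ≤ s) (hst : s ≤ t) : disagreement du t ≤ gammaSup du s :=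
  le_csSup (hbdd.mono (Set.image_mono (Set.Ici_subset_Ici.2 hs))) ⟨t, hst, rfl⟩

theorem gammaSup_nonneg (t : ℝ) : 0 ≤ gammaSup du t :=
  Real.sSup_nonneg (by rintro _ ⟨τ, -, rfl⟩; exact norm_nonneg _)

theorem exists_tendsto_gammaSup (hbdd : BddAbove (disagreement du '' Set.Ici t₀)) :
    ∃ γ : ℝ, Tendsto (gammaSup du) atTop (𝓝 γ) := by
  have hanti : Antitone fun t => gammaSup du (max t t₀) := by
    intro s t hst
    refine csSup_le_csSup (hbdd.mono (Set.image_mono (Set.Ici_subset_Ici.2 (le_max_right _ _))))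
      (Set.nonempty_Ici.image _)
      (Set.image_mono (Set.Ici_subset_Ici.2 (max_le_max_right _ hst)))
  have hlim := tendsto_atTop_ciInf hanti
    ⟨0, by rintro _ ⟨t, rfl⟩; exact gammaSup_nonneg _⟩
  refine ⟨_, hlim.congr' ?_⟩
  filter_upwards [eventually_ge_atTop t₀] with t ht
  rw [max_eq_left ht]

/-- The algorithm conserves `∑ x - ∑ u`, because the columns of a weight-balanced Laplacian sum to
zero. -/
theorem IsTrajectory.sum_sub_sum_eq (hbal : ∀ τ, t₀ ≤ τ → (G (σ τ)).WeightBalanced)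
    (hu : HasRate t₀ u du) (hx : IsTrajectory G σ t₀ du x) {t : ℝ} (ht : t₀ ≤ t) :
    ∑ i, x i t - ∑ i, u i t = ∑ i, x i t₀ - ∑ i, u i t₀ := by
  refine constant_of_has_deriv_right_zero (f := fun t => ∑ i, x i t - ∑ i, u i t) (a := t₀) (b := t)
    ?_ (fun τ hτ => ?_) t (Set.right_mem_Icc.2 ht)
  · exact (continuousOn_finsetSum _ fun i _ => (hx i).1.mono Set.Icc_subset_Ici_self).sub
      (continuousOn_finsetSum _ fun i _ => (hu i).1.mono Set.Icc_subset_Ici_self)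
  · have h := (HasDerivWithinAt.fun_sum (u := Finset.univ) fun i _ => (hx i).2 τ hτ.1).sub
      (HasDerivWithinAt.fun_sum (u := Finset.univ) fun i _ => (hu i).2 τ hτ.1)
    have h0 := (hbal τ hτ.1).sum_laplacian_mulVec fun i => x i τ
    simp only [WeightedDigraph.laplacian_mulVec_apply] at h0
    simp only [Finset.sum_add_distrib, Finset.sum_neg_distrib, h0, neg_zero, zero_add,
      sub_self] at h
    exact h

theorem abs_sub_avg_le_disagreement (x : Fin N → ℝ → ℝ) (i : Fin N) (t : ℝ) :
    |x i t - avg x t| ≤ disagreement x t := by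
  have h := abs_apply_le_norm (centering N *ᵥ fun i => x i t) i
  rwa [centering_mulVec_apply] at h

/-- In disagreement coordinates `z = Rᵀ x` the algorithm is the reduced Laplacian dynamics driven
by `Rᵀ u'`. -/
theorem IsTrajectory.disagreement_le (hσ : IsAdmissible G σ t₀) (hR : IsDisagreementBasis R)
    (hκ : 0 ≤ κ) (hlam : 0 < lam) (hb : UniformExpBound G σ t₀ R κ lam)
    (hbdd : BddAbove (disagreement du '' Set.Ici t₀)) (hx : IsTrajectory G σ t₀ du x) {s t : ℝ}
    (hs : t₀ ≤ s) (hst : s ≤ t) :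
    disagreement x t ≤
      κ * Real.exp (-lam * (t - s)) * disagreement x s + κ * gammaSup du s / lam := by
  let ℓ : (Fin N → ℝ) →L[ℝ] EuclideanSpace ℝ (Fin (N - 1)) := LinearMap.toContinuousLinearMap
    ((WithLp.linearEquiv 2 ℝ (Fin (N - 1) → ℝ)).symm.toLinearMap ∘ₗ mulVecLin Rᵀ)
  have hℓ : ∀ v, ℓ v = WithLp.toLp 2 (Rᵀ *ᵥ v) := fun v => rfl
  have hnorm : ∀ (v : Fin N → ℝ → ℝ) (τ : ℝ), ‖ℓ fun i => v i τ‖ = disagreement v τ :=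
    fun v τ => by rw [hℓ, hR.norm_transpose_mulVec, disagreement]
  rw [← hnorm x t, ← hnorm x s]
  refine hb.norm_le (z := fun τ => ℓ fun i => x i τ) (b := fun τ => ℓ fun i => du i τ)
    hσ hκ hlam hs hst ?_ (fun τ hτ => ?_)
    (fun τ hτ => (hnorm du τ).trans_le (disagreement_le_gammaSup hbdd hs hτ))
  · exact ℓ.continuous.comp_continuousOn
      (continuousOn_pi.2 fun i => (hx i).1.mono (Set.Ici_subset_Ici.2 hs))
  · have h := ℓ.hasFDerivAt.comp_hasDerivWithinAt τ
      (hasDerivWithinAt_pi.2 fun i => (hx i).2 τ (hs.trans hτ))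
    have hL : (G (σ τ)).laplacian *ᵥ (R *ᵥ (Rᵀ *ᵥ fun i => x i τ)) =
        (G (σ τ)).laplacian *ᵥ fun i => x i τ := by
      rw [mulVec_mulVec _ R, hR.mul_transpose,
        ← (G (σ τ)).laplacian_mulVec_add_const (fun i => x i τ) (-(1 / (N : ℝ) * ∑ j, x j τ))]
      congr 1
      ext i
      rw [centering_mulVec_apply, sub_eq_add_neg]
    have hA : toEuclideanCLM (𝕜 := ℝ) (Rᵀ * (G (σ τ)).laplacian * R) (ℓ fun i => x i τ) =
        ℓ ((G (σ τ)).laplacian *ᵥ fun i => x i τ) := by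
      rw [hℓ, hℓ, toEuclideanCLM_toLp, ← mulVec_mulVec, ← mulVec_mulVec, hL]
    have hv : (-((G (σ τ)).laplacian *ᵥ fun i => x i τ) + fun i => du i τ) =
        fun i => -(∑ j, (G (σ τ)).a i j * (x i τ - x j τ)) + du i τ := by
      ext i
      simp [WeightedDigraph.laplacian_mulVec_apply]
    rw [hA, ← map_neg, ← map_add, hv]
    exact h

end Consensus

theorem mainTheorem5 {N m : ℕ} (G : Fin m → WeightedDigraph N) (σ : ℝ → Fin m) (t₀ : ℝ)
    (hσ : IsAdmissible G σ t₀)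
    (R : Matrix (Fin N) (Fin (N - 1)) ℝ) (hR : IsDisagreementBasis R) :
    (∃ κ lam : ℝ, 1 ≤ κ ∧ 0 < lam ∧ UniformExpBound G σ t₀ R κ lam) ∧
    ∀ κ lam : ℝ, 1 ≤ κ → 0 < lam → UniformExpBound G σ t₀ R κ lam →
      ∀ u du x : Fin N → ℝ → ℝ, HasRate t₀ u du →
        BddAbove (disagreement du '' Set.Ici t₀) →
        IsTrajectory G σ t₀ du x →
        (∃ C : ℝ, ∀ i, ∀ t, t₀ ≤ t → |x i t - avg u t| ≤ C) ∧
        ((∃ B : ℝ, ∀ t, t₀ ≤ t → |avg u t| ≤ B) →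
          ∃ C : ℝ, ∀ i, ∀ t, t₀ ≤ t → |x i t| ≤ C) ∧
        (∑ i, x i t₀ = ∑ i, u i t₀ →
          (∃ γinf : ℝ, Tendsto (gammaSup du) atTop (𝓝 γinf) ∧
            ∀ i, ∀ ε : ℝ, 0 < ε →
              ∀ᶠ t in atTop, |x i t - avg u t| ≤ κ * γinf / lam + ε) ∧
          (∀ i, ∀ s t, t₀ ≤ s → s ≤ t →
            |x i t - avg u t| ≤
              κ * Real.exp (-lam * (t - s)) * disagreement x s + κ * gammaSup du s / lam) ∧
          ∀ t, t₀ ≤ t → ∑ i, x i t = ∑ i, u i t) := by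
  refine ⟨exists_uniformExpBound hσ hR, fun κ lam hκ hlam hb u du x hu hbdd hx => ?_⟩
  have hκ0 : 0 ≤ κ := zero_le_one.trans hκ
  have hbal : ∀ τ, t₀ ≤ τ → (G (σ τ)).WeightBalanced := by
    obtain ⟨_, _, _, _, h, _⟩ := hσ
    exact h
  have hsum := fun t (ht : t₀ ≤ t) => hx.sum_sub_sum_eq hbal hu ht
  have hdis := fun s t (hs : t₀ ≤ s) (hst : s ≤ t) =>
    hx.disagreement_le hσ hR hκ0 hlam hb hbdd hs hst
  have havg : ∀ t, t₀ ≤ t → avg x t - avg u t = 1 / (N : ℝ) * (∑ i, x i t₀ - ∑ i, u i t₀) := by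
    intro t ht
    rw [avg, avg, ← mul_sub, hsum t ht]
  have hbound : ∃ C : ℝ, ∀ i, ∀ t, t₀ ≤ t → |x i t - avg u t| ≤ C := by
    refine ⟨κ * disagreement x t₀ + κ * gammaSup du t₀ / lam +
      |1 / (N : ℝ) * (∑ i, x i t₀ - ∑ i, u i t₀)|, fun i t ht => ?_⟩
    have h1 : x i t - avg u t = (x i t - avg x t) + (avg x t - avg u t) := by ring
    have h2 : Real.exp (-lam * (t - t₀)) ≤ 1 := Real.exp_le_one_iff.2 (by nlinarith)
    have h3 : κ * Real.exp (-lam * (t - t₀)) * disagreement x t₀ ≤ κ * disagreement x t₀ :=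
      mul_le_mul_of_nonneg_right (mul_le_of_le_one_right hκ0 h2) (norm_nonneg _)
    rw [h1, ← havg t ht]
    linarith [abs_add_le (x i t - avg x t) (avg x t - avg u t),
      abs_sub_avg_le_disagreement x i t, hdis t₀ t le_rfl ht]
  refine ⟨hbound, fun ⟨B, hB⟩ => ?_, fun h0 => ?_⟩
  · obtain ⟨C, hC⟩ := hbound
    refine ⟨C + B, fun i t ht => ?_⟩
    have h1 := abs_add_le (x i t - avg u t) (avg u t)
    rw [sub_add_cancel] at h1
    linarith [hC i t ht, hB t ht]
  · have herr : ∀ i s t, t₀ ≤ s → s ≤ t → |x i t - avg u t| ≤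
        κ * Real.exp (-lam * (t - s)) * disagreement x s + κ * gammaSup du s / lam := by
      intro i s t hs hst
      have h1 := havg t (hs.trans hst)
      rw [h0, sub_self, mul_zero, sub_eq_zero] at h1
      rw [← h1]
      exact (abs_sub_avg_le_disagreement x i t).trans (hdis s t hs hst)
    refine ⟨?_, herr, fun t ht => ?_⟩
    · obtain ⟨γ, hγ⟩ := exists_tendsto_gammaSup hbdd
      refine ⟨γ, hγ, fun i ε hε => ?_⟩
      have hlim : Tendsto (fun s => κ * gammaSup du s / lam) atTop (𝓝 (κ * γ / lam)) :=
        (hγ.const_mul κ).div_const lam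
      -- First the restart time `s` makes the input term small, then `t` the transient.
      obtain ⟨s, hs, hst₀⟩ := ((hlim.eventually_lt_const
        (show κ * γ / lam < κ * γ / lam + ε / 2 by linarith)).and (eventually_ge_atTop t₀)).exists
      have htrans : Tendsto (fun t => κ * Real.exp (-lam * (t - s)) * disagreement x s) atTop
          (𝓝 (κ * 0 * disagreement x s)) := by
        refine ((Real.tendsto_exp_atBot.comp ?_).const_mul κ).mul_const _
        exact (tendsto_atTop_add_const_right _ (-s) tendsto_id).const_mul_atTop_of_neg
          (neg_neg_of_pos hlam)
      filter_upwards [htrans.eventually_lt_const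
        (show κ * 0 * disagreement x s < ε / 2 by simpa using hε), eventually_ge_atTop s]
        with t ht hst
      linarith [herr i s t hst₀ hst]
    · have := hsum t ht
      rw [h0, sub_self] at this
      exact sub_eq_zero.1 this
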